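/- Let $\mathbb{K}\in\{\mathbb{R},\mathbb{C}\}$, let $p,q\in[1,\infty]$, let $c,c'>0$, and set \[ \psi\colon [1,\infty)\to\mathbb{R},\qquad \psi(t)=c\,t\,(\log_2 t-c'). \] Let $c_0>0$ and $\mu_n = c_0\exp\{-\ln(2)\,\psi(n)\}$ for $n\in\mathbb{N}^*=\{1,2,\dots\}$, and let \[ \mathcal{E}_p=\Bigl\{x\in\ell^p(\mathbb{N}^*;\mathbb{K}) : \Bigl(\sum_{n\ge 1}|x_n/\mu_n|^p\Bigr)^{1/p}\le 1\Bigr\} \] (with $\sup_{n}|x_n/\mu_n|\le 1$ if $p=\infty$) be the $p$-ellipsoid with semi-axes $(\mu_n)$. For $\varepsilon>0$ let $N(\varepsilon;\mathcal{E}_p,\|\cdot\|_q)$ be the least number of closed $\|\cdot\|_q$-balls of radius $\varepsilon$ with centres in $\ell^q(\mathbb{N}^*;\mathbb{K})$ that cover $\mathcal{E}_p$, and let $H(\varepsilon;\mathcal{E}_p,\|\cdot\|_q)=\log_2 N(\varepsilon;\mathcal{E}_p,\|\cdot\|_q)$ be the metric entropy. Let $W$ denote the Lambert $W$-function, i.e.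 $W(x)e^{W(x)}=x$ for $x\ge 0$. Then $\mathcal{E}_p$ is a compact subset of $\ell^q(\mathbb{N}^*;\mathbb{K})$ (so that these quantities are finite), and, as $\varepsilon\to 0^+$, \[ H(\varepsilon;\mathcal{E}_p,\|\cdot\|_q)=\frac{\alpha\,c\,2^{2c'-1}}{\ln 2}\;e^{2\beta(\varepsilon)}\Bigl(\beta(\varepsilon)+\tfrac12\Bigr)\Bigl(1+O\bigl(e^{-\beta(\varepsilon)}\bigr)\Bigr), \qquad \beta(\varepsilon)=W\!\left(\frac{\ln(\varepsilon^{-1})}{2^{c'}c}\right), \] where $\alpha=1$ if $\mathbb{K}=\mathbb{R}$ and $\alpha=2$ if $\mathbb{K}=\mathbb{C}$. The main term on the right-hand side does not depend on $p$, $q$ or $c_0$; the implied constant may depend on $p,q,c,c',c_0$. -/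

import Mathlib

open Filter Topology Asymptotics
open scoped ENNReal NNReal

noncomputable section

/-- The metric entropy `log₂ N(ε; A)` of a set `A`, where `N(ε; A)` is the least number of closed
balls of radius `ε`, with centres anywhere in the ambient space, that cover `A`.
The covering number is finite when `A` is compact and `ε > 0`. -/
def metricEntropy {X : Type*} [MetricSpace X] (ε : ℝ) (A : Set X) : ℝ :=
  Real.logb 2 ((Metric.externalCoveringNumber ε.toNNReal A).toNat : ℝ)

/-- The ellipsoid norm `‖x‖_{p,μ} = (∑ |xₙ / μₙ|^p)^(1/p)` (a supremum if `p = ∞`), with value in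
`[0, ∞]`. -/
def ellipsoidNorm {𝕂 : Type*} [RCLike 𝕂] (p : ℝ≥0∞) (μ : ℕ+ → ℝ) (x : ℕ+ → 𝕂) : ℝ≥0∞ :=
  if p = ∞ then ⨆ n, ‖x n‖ₑ / ENNReal.ofReal (μ n)
  else (∑' n, (‖x n‖ₑ / ENNReal.ofReal (μ n)) ^ p.toReal) ^ (1 / p.toReal)

/-- The infinite-dimensional `p`-ellipsoid with semi-axes `μ`, a subset of `ℓ^p`. -/
def ellipsoid (𝕂 : Type*) [RCLike 𝕂] (p : ℝ≥0∞) (μ : ℕ+ → ℝ) : Set (ℕ+ → 𝕂) :=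
  {x | Memℓp x p ∧ ellipsoidNorm p μ x ≤ 1}

/-- The elements of the `p`-ellipsoid that belong to `ℓ^q`, as a subset of the normed space
`ℓ^q`. -/
def ellipsoidIn (𝕂 : Type*) [RCLike 𝕂] (p q : ℝ≥0∞) (μ : ℕ+ → ℝ) :
    Set (lp (fun _ : ℕ+ => 𝕂) q) :=
  {x | (x : ℕ+ → 𝕂) ∈ ellipsoid 𝕂 p μ}

/-- The semi-axes are `μₙ = c₀ exp(-ln 2 · ψ(n))` for some `c₀ > 0`. -/
def HasExpDecayingSemiaxes (ψ : ℝ → ℝ) (μ : ℕ+ → ℝ) : Prop :=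
  ∃ c₀ : ℝ, 0 < c₀ ∧ ∀ n : ℕ+, μ n = c₀ * Real.exp (-(Real.log 2 * ψ (n : ℝ)))

/-- The number `α`, equal to `1` for `𝕂 = ℝ` and to `2` for `𝕂 = ℂ`. -/
def realDim (𝕂 : Type*) [RCLike 𝕂] : ℝ := (Module.finrank ℝ 𝕂 : ℝ)

theorem realDim_real : realDim ℝ = 1 := by simp [realDim]

theorem realDim_complex : realDim ℂ = 2 := by simp [realDim]

/-- The Lambert `W`-function on `[0, ∞)`. -/
def lambertW (x : ℝ) : ℝ := sSup {y : ℝ | y * Real.exp y ≤ x}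

theorem mul_exp_strictMonoOn : StrictMonoOn (fun y : ℝ => y * Real.exp y) (Set.Ici 0) := by
  intro a ha b hb hab
  exact mul_lt_mul'' hab (Real.exp_lt_exp.2 hab) ha (Real.exp_pos a).le

/-- `W(x)` is the unique solution `y` of `y e^y = x`, for `x ≥ 0`. -/
theorem eq_lambertW_iff {x : ℝ} (hx : 0 ≤ x) (y : ℝ) :
    y = lambertW x ↔ y * Real.exp y = x := by
  have key : ∀ z : ℝ, z * Real.exp z = x → lambertW x = z := by
    intro z hz
    have hz0 : 0 ≤ z := by
      by_contra h
      have := mul_neg_of_neg_of_pos (not_le.1 h) (Real.exp_pos z)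
      linarith
    refine IsGreatest.csSup_eq ⟨hz.le, ?_⟩
    intro w hw
    by_contra h
    have h1 := mul_exp_strictMonoOn (Set.mem_Ici.2 hz0)
      (Set.mem_Ici.2 (hz0.trans (not_le.1 h).le)) (not_le.1 h)
    have hw' : w * Real.exp w ≤ x := hw
    simp only at h1
    linarith
  have hex : ∃ z : ℝ, z * Real.exp z = x := by
    have hc : ContinuousOn (fun y : ℝ => y * Real.exp y) (Set.Icc 0 x) := by fun_prop
    have h := intermediate_value_Icc hx hc
    have hmem : x ∈ Set.Icc ((fun y : ℝ => y * Real.exp y) 0)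
        ((fun y : ℝ => y * Real.exp y) x) := by
      refine ⟨by simpa using hx, ?_⟩
      exact le_mul_of_one_le_right hx (Real.one_le_exp hx)
    obtain ⟨z, -, hz⟩ := h hmem
    exact ⟨z, hz⟩
  obtain ⟨z, hz⟩ := hex
  constructor
  · rintro rfl
    rw [key z hz, hz]
  · intro h
    exact (key y h).symm

end

/-! Put `a = c' log 2` and `N = exp (a + β(ε))`. The equation defining `W` says exactly that `ε =
exp (-(c N β))`, and since `log 2 · ψ(t) = c t (log t - a)`, the cutoff `N` is where the semi-axes
fall to size `c₀ ε`. Essentially only the first `⌊N⌋` coordinates count.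

The exponents `p` and `q` are removed by crude comparisons. The ellipsoid lies in the box with radii
`μₙ` and contains the box with radii `μₙ / D` on any `D` coordinates; the `ℓ^q` norm lies between
the sup and `ℓ^1` norms. With `D` of order `N`, each comparison costs a factor polynomial in `N` per
coordinate, hence `O(N β)` in the entropy. Volume ratios of boxes then give
`externalCoveringNumber_ellipsoidIn_le` (the tail past the cutoff has `ℓ^1` mass at most `ε / 2`, by
`sum_tail_semiaxes_le`) and `prod_le_externalCoveringNumber_ellipsoidIn`.

Both bounds have the leading term `∑_{n ≤ N} (c N β - c n (log n - a))` times the real dimension.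
Comparison with the integral of `t log t` in `abs_sum_semiaxisExponent_sub_le` evaluates it as `(c
N² / 2)(β + 1/2) + O(N (β + 1))`. The relative error is `O(1/N) = O(exp (-β))`. -/

/-! ### Volume bounds for coverings of polydiscs -/

open MeasureTheory in
/-- A separated subset of a polydisc has cardinality controlled by a volume ratio. -/
theorem card_le_of_separated_polydisc {𝕂 ι : Type*} [RCLike 𝕂] [Fintype ι] {r : ι → ℝ}
    (hr : ∀ i, 0 ≤ r i) {δ : ℝ} (hδ : 0 < δ) (C : Finset (ι → 𝕂))
    (hC : ∀ x ∈ C, ∀ i, ‖x i‖ ≤ r i) (hsep : ∀ x ∈ C, ∀ y ∈ C, x ≠ y → δ ≤ dist x y) :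
    (C.card : ℝ) ≤ ∏ i, (1 + 2 * r i / δ) ^ Module.finrank ℝ 𝕂 := by
  -- The Haar volume of the unit ball is never computed: it occurs to the same power on both sides
  -- and cancels.
  set v : ℝ≥0∞ := (Measure.addHaar : Measure 𝕂) (Metric.ball 0 1) with hv
  have hv0 : v ≠ 0 := (Metric.measure_ball_pos _ _ one_pos).ne'
  have hvt : v ≠ ∞ := measure_ball_lt_top.ne
  let ν : Measure (ι → 𝕂) := Measure.pi fun _ => Measure.addHaar
  have hball : ∀ x : ι → 𝕂, ν (Metric.ball x (δ / 2)) =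
      ENNReal.ofReal (∏ _i : ι, (δ / 2) ^ Module.finrank ℝ 𝕂) * v ^ Fintype.card ι := by
    intro x
    rw [ball_pi _ (half_pos hδ), Measure.pi_pi]
    simp only [Measure.addHaar_ball_of_pos _ _ (half_pos hδ)]
    rw [Finset.prod_mul_distrib, Finset.prod_const, Finset.prod_const, Finset.card_univ,
      ENNReal.ofReal_prod_of_nonneg fun _ _ => by positivity, Finset.prod_const, Finset.card_univ]
  have hbig : ν (Set.pi Set.univ fun i => Metric.closedBall (0 : 𝕂) (r i + δ / 2)) =
      ENNReal.ofReal (∏ i : ι, (r i + δ / 2) ^ Module.finrank ℝ 𝕂) * v ^ Fintype.card ι := by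
    rw [Measure.pi_pi, ENNReal.ofReal_prod_of_nonneg fun i _ => by have := hr i; positivity]
    rw [← Finset.card_univ, ← Finset.prod_const, ← Finset.prod_mul_distrib]
    exact Finset.prod_congr rfl fun i _ =>
      Measure.addHaar_closedBall _ _ (by have := hr i; positivity)
  have hdisj : (C : Set (ι → 𝕂)).PairwiseDisjoint fun x => Metric.ball x (δ / 2) := by
    intro x hx y hy hxy
    exact Metric.ball_disjoint_ball (by linarith [hsep x hx y hy hxy])
  have hsub : (⋃ x ∈ C, Metric.ball x (δ / 2)) ⊆
      Set.pi Set.univ fun i => Metric.closedBall (0 : 𝕂) (r i + δ / 2) := by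
    intro z hz i _
    simp only [Set.mem_iUnion] at hz
    obtain ⟨x, hx, hz⟩ := hz
    have h1 := (dist_le_pi_dist z x i).trans (Metric.mem_ball.1 hz).le
    rw [dist_eq_norm] at h1
    rw [mem_closedBall_zero_iff]
    calc ‖z i‖ = ‖x i + (z i - x i)‖ := by congr 1; ring
      _ ≤ ‖x i‖ + ‖z i - x i‖ := norm_add_le _ _
      _ ≤ _ := add_le_add (hC x hx i) h1
  have hmeas := measure_mono (μ := ν) hsub
  rw [measure_biUnion_finset hdisj fun _ _ => measurableSet_ball, hbig] at hmeas
  simp only [hball, Finset.sum_const, nsmul_eq_mul] at hmeas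
  rw [← mul_assoc, ENNReal.mul_le_mul_iff_left (pow_ne_zero _ hv0) (ENNReal.pow_ne_top hvt),
    ← ENNReal.ofReal_natCast, ← ENNReal.ofReal_mul (Nat.cast_nonneg _),
    ENNReal.ofReal_le_ofReal_iff (Finset.prod_nonneg fun i _ => by have := hr i; positivity)]
    at hmeas
  have hpos : 0 < ∏ _i : ι, (δ / 2) ^ Module.finrank ℝ 𝕂 := Finset.prod_pos fun _ _ => by positivity
  refine le_of_mul_le_mul_right (hmeas.trans_eq ?_) hpos
  rw [← Finset.prod_mul_distrib]
  refine Finset.prod_congr rfl fun i _ => ?_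
  rw [← mul_pow]
  congr 1
  field_simp
  ring

open MeasureTheory in
/-- A finite cover of a polydisc by sup-norm balls has cardinality at least the volume ratio. -/
theorem prod_le_card_of_cover_polydisc {𝕂 ι : Type*} [RCLike 𝕂] [Fintype ι] {r : ι → ℝ}
    (hr : ∀ i, 0 ≤ r i) {ε : ℝ} (hε : 0 < ε) (C : Finset (ι → 𝕂))
    (hC : ∀ x : ι → 𝕂, (∀ i, ‖x i‖ ≤ r i) → ∃ y ∈ C, dist x y ≤ ε) :
    ∏ i, (r i / ε) ^ Module.finrank ℝ 𝕂 ≤ (C.card : ℝ) := by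
  set v : ℝ≥0∞ := (Measure.addHaar : Measure 𝕂) (Metric.ball 0 1) with hv
  have hv0 : v ≠ 0 := (Metric.measure_ball_pos _ _ one_pos).ne'
  have hvt : v ≠ ∞ := measure_ball_lt_top.ne
  let ν : Measure (ι → 𝕂) := Measure.pi fun _ => Measure.addHaar
  have hpi : ∀ (x : ι → 𝕂) (ρ : ι → ℝ), (∀ i, 0 ≤ ρ i) →
      ν (Set.pi Set.univ fun i => Metric.closedBall (x i) (ρ i)) =
      ENNReal.ofReal (∏ i : ι, (ρ i) ^ Module.finrank ℝ 𝕂) * v ^ Fintype.card ι := by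
    intro x ρ hρ
    rw [Measure.pi_pi, ENNReal.ofReal_prod_of_nonneg fun i _ => by have := hρ i; positivity]
    rw [← Finset.card_univ, ← Finset.prod_const, ← Finset.prod_mul_distrib]
    exact Finset.prod_congr rfl fun i _ => Measure.addHaar_closedBall _ _ (hρ i)
  have hsub : (Set.pi Set.univ fun i => Metric.closedBall (0 : 𝕂) (r i)) ⊆
      ⋃ y ∈ C, Set.pi Set.univ fun i => Metric.closedBall (y i) ε := by
    intro x hx
    obtain ⟨y, hy, hxy⟩ := hC x fun i => mem_closedBall_zero_iff.1 (hx i trivial)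
    exact Set.mem_biUnion hy fun i _ => (dist_le_pi_dist x y i).trans hxy
  have hmeas := (measure_mono (μ := ν) hsub).trans (measure_biUnion_finset_le _ _)
  rw [hpi (fun _ => 0) r hr] at hmeas
  simp only [hpi _ (fun _ => ε) fun _ => hε.le, Finset.sum_const, nsmul_eq_mul] at hmeas
  rw [← mul_assoc, ENNReal.mul_le_mul_iff_left (pow_ne_zero _ hv0) (ENNReal.pow_ne_top hvt),
    ← ENNReal.ofReal_natCast, ← ENNReal.ofReal_mul (Nat.cast_nonneg _),
    ENNReal.ofReal_le_ofReal_iff (mul_nonneg (Nat.cast_nonneg _)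
      (Finset.prod_nonneg fun i _ => by positivity))] at hmeas
  have hpos : 0 < ∏ _i : ι, ε ^ Module.finrank ℝ 𝕂 := Finset.prod_pos fun _ _ => by positivity
  refine le_of_mul_le_mul_right (le_of_eq_of_le ?_ hmeas) hpos
  rw [← Finset.prod_mul_distrib]
  refine Finset.prod_congr rfl fun i _ => ?_
  rw [← mul_pow, div_mul_cancel₀ _ hε.ne']

/-- A polydisc has a finite sup-norm `δ`-net whose size is controlled by a volume ratio. -/
theorem exists_net_polydisc {𝕂 ι : Type*} [RCLike 𝕂] [Fintype ι] {r : ι → ℝ}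
    (hr : ∀ i, 0 ≤ r i) {δ : ℝ} (hδ : 0 < δ) :
    ∃ C : Finset (ι → 𝕂), (C.card : ℝ) ≤ ∏ i, (1 + 2 * r i / δ) ^ Module.finrank ℝ 𝕂 ∧
      ∀ x : ι → 𝕂, (∀ i, ‖x i‖ ≤ r i) → ∃ y ∈ C, dist x y ≤ δ := by
  set M : ℝ := ∏ i, (1 + 2 * r i / δ) ^ Module.finrank ℝ 𝕂 with hM
  have hM0 : 0 ≤ M := Finset.prod_nonneg fun i _ => by have := hr i; positivity
  set A : Set (ι → 𝕂) := {x | ∀ i, ‖x i‖ ≤ r i} with hA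
  have hcard : ∀ C : Finset (ι → 𝕂), (C : Set (ι → 𝕂)) ⊆ A →
      Metric.IsSeparated (δ.toNNReal : ℝ≥0∞) (C : Set (ι → 𝕂)) → (C.card : ℝ) ≤ M := by
    intro C hCA hsep
    refine card_le_of_separated_polydisc hr hδ C (fun x hx => hCA hx) fun x hx y hy hxy => ?_
    have h := (hsep hx hy hxy).le
    rw [edist_dist] at h
    exact (ENNReal.ofReal_le_ofReal_iff dist_nonneg).1 h
  have hpack : Metric.packingNumber δ.toNNReal A ≤ (⌊M⌋₊ : ℕ∞) := by
    refine iSup₂_le fun C hCA => iSup_le fun hsep => ?_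
    by_contra! hlt
    -- The separated set may be infinite, so the volume bound is applied to a subset with exactly
    -- `⌊M⌋₊ + 1` points.
    obtain ⟨t, htC, ht⟩ := Set.exists_subset_encard_eq (Order.add_one_le_of_lt hlt)
    have htf : t.Finite := Set.finite_of_encard_eq_coe (k := ⌊M⌋₊ + 1) (by exact_mod_cast ht)
    have h1 := hcard htf.toFinset (by simpa using htC.trans hCA)
      (by simpa using hsep.subset htC)
    have h2 : htf.toFinset.card = ⌊M⌋₊ + 1 := by
      rw [htf.encard_eq_coe_toFinset_card] at ht
      exact_mod_cast ht
    rw [h2] at h1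
    push_cast at h1
    linarith [Nat.lt_floor_add_one M]
  have hcov := (Metric.coveringNumber_le_packingNumber _ _).trans hpack
  obtain ⟨C, -, hCf, hCc, hCe⟩ := Metric.exists_set_encard_eq_coveringNumber
    (ne_top_of_le_ne_top (ENat.natCast_ne_top _) hcov)
  refine ⟨hCf.toFinset, ?_, fun x hx => ?_⟩
  · rw [← hCe, hCf.encard_eq_coe_toFinset_card] at hcov
    exact (Nat.cast_le.2 (by exact_mod_cast hcov)).trans (Nat.floor_le hM0)
  · obtain ⟨y, hy, hxy⟩ := hCc (show x ∈ A from hx)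
    refine ⟨y, by simpa using hy, ?_⟩
    change edist x y ≤ _ at hxy
    rw [edist_dist] at hxy
    exact (ENNReal.ofReal_le_ofReal_iff hδ.le).1 hxy

/-! ### Ellipsoids, boxes and sequence norms -/

/-- The `ℓ^q` norm is at most the `ℓ^1` norm. -/
theorem lp.norm_le_of_forall_sum_norm_le {α : Type*} {E : α → Type*}
    [∀ i, NormedAddCommGroup (E i)] {q : ℝ≥0∞} (hq : 1 ≤ q) {C : ℝ} (hC : 0 ≤ C) {f : lp E q}
    (hf : ∀ s : Finset α, ∑ i ∈ s, ‖f i‖ ≤ C) : ‖f‖ ≤ C := by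
  have hcoord : ∀ i, ‖f i‖ ≤ C := fun i => by simpa using hf {i}
  rcases eq_or_ne q ∞ with rfl | hqt
  · exact lp.norm_le_of_forall_le hC hcoord
  have hq1 : 1 ≤ q.toReal := by
    rw [← ENNReal.toReal_one]; exact ENNReal.toReal_mono hqt hq
  have hsplit : ∀ a : ℝ, 0 ≤ a → a ^ q.toReal = a * a ^ (q.toReal - 1) := by
    intro a ha
    conv_rhs => enter [1]; rw [← Real.rpow_one a]
    rw [← Real.rpow_add_of_nonneg ha zero_le_one (by linarith)]
    congr 1
    ring
  refine lp.norm_le_of_forall_sum_le (by linarith) hC fun s => ?_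
  calc ∑ i ∈ s, ‖f i‖ ^ q.toReal ≤ ∑ i ∈ s, ‖f i‖ * C ^ (q.toReal - 1) := by
        refine Finset.sum_le_sum fun i _ => ?_
        rw [hsplit _ (norm_nonneg _)]
        exact mul_le_mul_of_nonneg_left
          (Real.rpow_le_rpow (norm_nonneg _) (hcoord i) (by linarith)) (norm_nonneg _)
    _ = (∑ i ∈ s, ‖f i‖) * C ^ (q.toReal - 1) := by rw [Finset.sum_mul]
    _ ≤ C * C ^ (q.toReal - 1) :=
        mul_le_mul_of_nonneg_right (hf s) (Real.rpow_nonneg hC _)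
    _ = C ^ q.toReal := (hsplit C hC).symm

theorem ellipsoidNorm_le_one_iff {𝕂 : Type*} [RCLike 𝕂] {p : ℝ≥0∞} (hp : 1 ≤ p) (hpt : p ≠ ∞)
    (μ : ℕ+ → ℝ) (x : ℕ+ → 𝕂) :
    ellipsoidNorm p μ x ≤ 1 ↔
      ∀ s : Finset ℕ+, ∑ n ∈ s, (‖x n‖ₑ / ENNReal.ofReal (μ n)) ^ p.toReal ≤ 1 := by
  have hp0 : 0 < p.toReal := ENNReal.toReal_pos (zero_lt_one.trans_le hp).ne' hpt
  rw [ellipsoidNorm, if_neg hpt]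
  nth_rewrite 1 [← ENNReal.one_rpow (1 / p.toReal)]
  rw [ENNReal.rpow_le_rpow_iff (by positivity), ENNReal.tsum_eq_iSup_sum, iSup_le_iff]

theorem enorm_div_le_one_iff {𝕂 : Type*} [RCLike 𝕂] {a : ℝ} (ha : 0 < a) (z : 𝕂) :
    ‖z‖ₑ / ENNReal.ofReal a ≤ 1 ↔ ‖z‖ ≤ a := by
  rw [ENNReal.div_le_iff (by simpa using ha) ENNReal.ofReal_ne_top, one_mul,
    ← ofReal_norm, ENNReal.ofReal_le_ofReal_iff ha.le]

theorem norm_le_of_ellipsoidNorm_le_one {𝕂 : Type*} [RCLike 𝕂] {p : ℝ≥0∞} (hp : 1 ≤ p)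
    {μ : ℕ+ → ℝ} (hμ : ∀ n, 0 < μ n) {x : ℕ+ → 𝕂} (hx : ellipsoidNorm p μ x ≤ 1) (n : ℕ+) :
    ‖x n‖ ≤ μ n := by
  rw [← enorm_div_le_one_iff (hμ n)]
  by_cases hpt : p = ∞
  · rw [ellipsoidNorm, if_pos hpt, iSup_le_iff] at hx
    exact hx n
  · have hp0 : 0 < p.toReal := ENNReal.toReal_pos (zero_lt_one.trans_le hp).ne' hpt
    have h := (ellipsoidNorm_le_one_iff hp hpt μ x).1 hx {n}
    rw [Finset.sum_singleton, ← ENNReal.one_rpow p.toReal, ENNReal.rpow_le_rpow_iff hp0] at h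
    exact h

theorem memℓp_of_norm_le_summable {𝕂 : Type*} [RCLike 𝕂] {p : ℝ≥0∞} (hp : 1 ≤ p)
    {μ : ℕ+ → ℝ} (hs : Summable μ) {x : ℕ+ → 𝕂} (hx : ∀ n, ‖x n‖ ≤ μ n) : Memℓp x p := by
  refine Memℓp.of_exponent_ge (q := 1) (memℓp_gen ?_) hp
  simpa using Summable.of_nonneg_of_le (fun n => norm_nonneg (x n)) hx hs

/-- Summability of `μ` makes membership in `ℓ^p` automatic. What remains is an intersection of
closed conditions, each involving finitely many coordinates, and coordinates are continuous on
`ℓ^q`. -/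
theorem isClosed_ellipsoidIn {𝕂 : Type*} [RCLike 𝕂] {p q : ℝ≥0∞} [hp : Fact (1 ≤ p)]
    [Fact (1 ≤ q)] {μ : ℕ+ → ℝ} (hμ : ∀ n, 0 < μ n) (hs : Summable μ) :
    IsClosed (ellipsoidIn 𝕂 p q μ) := by
  have hset : ellipsoidIn 𝕂 p q μ =
      {x : lp (fun _ : ℕ+ => 𝕂) q | ellipsoidNorm p μ (x : ℕ+ → 𝕂) ≤ 1} := by
    ext x
    exact ⟨fun h => h.2, fun h => ⟨memℓp_of_norm_le_summable hp.out hs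
      (norm_le_of_ellipsoidNorm_le_one hp.out hμ h), h⟩⟩
  have hcont : ∀ n : ℕ+, Continuous fun x : lp (fun _ : ℕ+ => 𝕂) q =>
      ‖(x : ℕ+ → 𝕂) n‖ₑ / ENNReal.ofReal (μ n) := fun n =>
    ENNReal.continuous_div_const _ (by simpa using hμ n) |>.comp
      (lp.lipschitzWith_one_eval q n).continuous.enorm
  rw [hset]
  by_cases hpt : p = ∞
  · simp only [ellipsoidNorm, if_pos hpt, iSup_le_iff, Set.ofPred_forall]
    exact isClosed_iInter fun n => isClosed_le (hcont n) continuous_const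
  · simp only [ellipsoidNorm_le_one_iff hp.out hpt, Set.ofPred_forall]
    exact isClosed_iInter fun s => isClosed_le
      (continuous_finsetSum _ fun n _ => (ENNReal.continuous_rpow_const).comp (hcont n))
      continuous_const

/-- The ratios `|xₙ| / μₙ` are at most `1` and sum to at most `1`, so their `p`-th powers do too.
This inscribed box serves every `p` in the lower bound. -/
theorem mem_ellipsoid_of_norm_le_div_card {𝕂 : Type*} [RCLike 𝕂] {p : ℝ≥0∞} (hp : 1 ≤ p)
    {μ : ℕ+ → ℝ} (hμ : ∀ n, 0 < μ n) (s : Finset ℕ+) {x : ℕ+ → 𝕂}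
    (hx : ∀ n ∈ s, ‖x n‖ ≤ μ n / s.card) (hx0 : ∀ n ∉ s, x n = 0) : x ∈ ellipsoid 𝕂 p μ := by
  have hle : ∀ n ∈ s, ‖x n‖ₑ / ENNReal.ofReal (μ n) ≤ (s.card : ℝ≥0∞)⁻¹ := by
    intro n hn
    have hs : (0 : ℝ) < s.card := by exact_mod_cast Finset.card_pos.2 ⟨n, hn⟩
    rw [ENNReal.div_le_iff (by simpa using hμ n) ENNReal.ofReal_ne_top, ← ofReal_norm,
      ← ENNReal.ofReal_natCast, ← ENNReal.ofReal_inv_of_pos hs,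
      ← ENNReal.ofReal_mul (by positivity)]
    exact ENNReal.ofReal_le_ofReal ((hx n hn).trans_eq (by ring))
  have hle1 : ∀ n, ‖x n‖ₑ / ENNReal.ofReal (μ n) ≤ 1 := by
    intro n
    by_cases hn : n ∈ s
    · refine (hle n hn).trans (ENNReal.inv_le_one.2 ?_)
      exact_mod_cast Finset.card_pos.2 ⟨n, hn⟩
    · simp [hx0 n hn]
  have hfin : Memℓp x 0 := memℓp_zero (s.finite_toSet.subset fun n hn => by
    by_contra h; exact hn (hx0 n h))
  refine ⟨hfin.of_exponent_ge zero_le, ?_⟩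
  by_cases hpt : p = ∞
  · rw [ellipsoidNorm, if_pos hpt]
    exact iSup_le hle1
  · have hp1 : 1 ≤ p.toReal := by
      rw [← ENNReal.toReal_one]; exact ENNReal.toReal_mono hpt hp
    rw [ellipsoidNorm_le_one_iff hp hpt]
    intro t
    calc ∑ n ∈ t, (‖x n‖ₑ / ENNReal.ofReal (μ n)) ^ p.toReal
        ≤ ∑ n ∈ t, ‖x n‖ₑ / ENNReal.ofReal (μ n) :=
          Finset.sum_le_sum fun n _ => ENNReal.rpow_le_self_of_le_one (hle1 n) hp1
      _ ≤ ∑ n ∈ s, ‖x n‖ₑ / ENNReal.ofReal (μ n) := by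
          refine Finset.sum_le_sum_of_ne_zero fun n _ hn => ?_
          by_contra h
          exact hn (by simp [hx0 n h])
      _ ≤ ∑ n ∈ s, (s.card : ℝ≥0∞)⁻¹ := Finset.sum_le_sum hle
      _ ≤ 1 := by
          rw [Finset.sum_const, nsmul_eq_mul]
          exact ENNReal.mul_inv_le_one _

/-! ### Covering numbers and compactness of ellipsoids -/

/-- Upper bound for the covering number, obtained by discretising the coordinates in `s` and
discarding the others. -/
theorem externalCoveringNumber_ellipsoidIn_le {𝕂 : Type*} [RCLike 𝕂] {p q : ℝ≥0∞}
    [hp : Fact (1 ≤ p)] [hq : Fact (1 ≤ q)] {μ : ℕ+ → ℝ} (hμ : ∀ n, 0 < μ n) {ε : ℝ} (hε : 0 < ε)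
    (s : Finset ℕ+) (hs : s.Nonempty)
    (htail : ∀ t : Finset ℕ+, Disjoint t s → ∑ n ∈ t, μ n ≤ ε / 2) :
    ∃ k : ℕ, Metric.externalCoveringNumber ε.toNNReal (ellipsoidIn 𝕂 p q μ) ≤ k ∧
      (k : ℝ) ≤ ∏ n ∈ s, (1 + 4 * s.card * μ n / ε) ^ Module.finrank ℝ 𝕂 := by
  classical
  have hs0 : (0 : ℝ) < s.card := by exact_mod_cast hs.card_pos
  -- A sup-norm error `ε / (2 |s|)` on `|s|` coordinates has `ℓ^1` size at most `ε / 2`; the other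
  -- half of `ε` is left for the tail.
  obtain ⟨C, hCc, hC⟩ := exists_net_polydisc (𝕂 := 𝕂) (r := fun n : s => μ n)
    (fun n => (hμ n).le) (δ := ε / (2 * s.card)) (by positivity)
  let ext : (s → 𝕂) → lp (fun _ : ℕ+ => 𝕂) q := fun y =>
    ⟨fun n => if h : n ∈ s then y ⟨n, h⟩ else 0, (memℓp_zero (s.finite_toSet.subset fun n hn => by
      by_contra h; exact hn (dif_neg h))).of_exponent_ge zero_le⟩
  refine ⟨(C.image ext).card, ?_, ?_⟩
  · rw [← Set.encard_coe_eq_coe_finsetCard]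
    refine Metric.IsCover.externalCoveringNumber_le_encard fun x hx => ?_
    have hxμ := norm_le_of_ellipsoidNorm_le_one hp.out hμ hx.2
    obtain ⟨y, hy, hxy⟩ := hC (fun n : s => (x : ℕ+ → 𝕂) n) fun n => hxμ n
    refine ⟨ext y, by simpa using ⟨y, hy, rfl⟩, ?_⟩
    change edist x (ext y) ≤ _
    rw [edist_dist]
    refine ENNReal.ofReal_le_ofReal ?_
    rw [dist_eq_norm]
    refine lp.norm_le_of_forall_sum_norm_le hq.out hε.le fun t => ?_
    have hin : ∀ n ∈ s, ‖(x - ext y : lp (fun _ : ℕ+ => 𝕂) q) n‖ ≤ ε / (2 * s.card) := by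
      intro n hn
      have h1 := (dist_le_pi_dist _ y ⟨n, hn⟩).trans hxy
      rw [dist_eq_norm] at h1
      rw [lp.coeFn_sub, Pi.sub_apply]
      simpa [ext, hn] using h1
    have hout : ∀ n ∉ s, ‖(x - ext y : lp (fun _ : ℕ+ => 𝕂) q) n‖ ≤ μ n := by
      intro n hn
      rw [lp.coeFn_sub, Pi.sub_apply]
      simpa [ext, hn] using hxμ n
    rw [← Finset.sum_filter_add_sum_filter_not t (· ∈ s)]
    have h1 : ∑ n ∈ t.filter (· ∈ s), ‖(x - ext y : lp (fun _ : ℕ+ => 𝕂) q) n‖ ≤ ε / 2 :=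
      calc _ ≤ ∑ n ∈ s, ‖(x - ext y : lp (fun _ : ℕ+ => 𝕂) q) n‖ :=
            Finset.sum_le_sum_of_subset_of_nonneg
              (fun n hn => (Finset.mem_filter.1 hn).2) fun _ _ _ => norm_nonneg _
        _ ≤ ∑ n ∈ s, ε / (2 * s.card) := Finset.sum_le_sum hin
        _ = ε / 2 := by rw [Finset.sum_const, nsmul_eq_mul]; field_simp
    have h2 : ∑ n ∈ t.filter (· ∉ s), ‖(x - ext y : lp (fun _ : ℕ+ => 𝕂) q) n‖ ≤ ε / 2 :=
      (Finset.sum_le_sum fun n hn => hout n (Finset.mem_filter.1 hn).2).trans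
        (htail _ (Finset.disjoint_left.2 fun n hn => (Finset.mem_filter.1 hn).2))
    linarith
  · refine (Nat.cast_le.2 Finset.card_image_le).trans (hCc.trans_eq ?_)
    rw [← Finset.prod_coe_sort s]
    refine Finset.prod_congr rfl fun n _ => ?_
    congr 2
    field_simp
    ring

/-- Restriction to `s` does not increase distances from `ℓ^q` to the sup norm, so the restricted
centres of any cover also cover the inscribed box, and the volume bound applies. -/
theorem prod_le_externalCoveringNumber_ellipsoidIn {𝕂 : Type*} [RCLike 𝕂] {p q : ℝ≥0∞}
    [hp : Fact (1 ≤ p)] [hq : Fact (1 ≤ q)] {μ : ℕ+ → ℝ} (hμ : ∀ n, 0 < μ n) {ε : ℝ} (hε : 0 < ε)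
    (s : Finset ℕ+)
    (hfin : Metric.externalCoveringNumber ε.toNNReal (ellipsoidIn 𝕂 p q μ) ≠ ⊤) :
    ∏ n ∈ s, (μ n / (s.card * ε)) ^ Module.finrank ℝ 𝕂 ≤
      ((Metric.externalCoveringNumber ε.toNNReal (ellipsoidIn 𝕂 p q μ)).toNat : ℝ) := by
  classical
  obtain ⟨C, hC, hCe⟩ : ∃ C, Metric.IsCover ε.toNNReal (ellipsoidIn 𝕂 p q μ) C ∧
      C.encard = Metric.externalCoveringNumber ε.toNNReal (ellipsoidIn 𝕂 p q μ) := by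
    have : Nonempty {C // Metric.IsCover ε.toNNReal (ellipsoidIn 𝕂 p q μ) C} :=
      ⟨_, Metric.IsCover.refl _ _⟩
    obtain ⟨C, hC⟩ := ENat.exists_eq_iInf
      fun C : {C // Metric.IsCover ε.toNNReal (ellipsoidIn 𝕂 p q μ) C} => C.1.encard
    exact ⟨C, C.2, by rw [hC, Metric.externalCoveringNumber, iInf_subtype]⟩
  rw [← hCe] at hfin ⊢
  have hCf : C.Finite := Set.encard_ne_top_iff.1 hfin
  let res : lp (fun _ : ℕ+ => 𝕂) q → (s → 𝕂) := fun x n => (x : ℕ+ → 𝕂) n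
  have hcov : ∀ x : s → 𝕂, (∀ i, ‖x i‖ ≤ μ i / s.card) →
      ∃ y ∈ hCf.toFinset.image res, dist x y ≤ ε := by
    intro x hx
    let f : ℕ+ → 𝕂 := fun n => if h : n ∈ s then x ⟨n, h⟩ else 0
    have hfmem : f ∈ ellipsoid 𝕂 p μ := mem_ellipsoid_of_norm_le_div_card hp.out hμ s
      (fun n hn => by simpa [f, hn] using hx ⟨n, hn⟩) fun n hn => dif_neg hn
    let g : lp (fun _ : ℕ+ => 𝕂) q := ⟨f, (memℓp_zero (s.finite_toSet.subset fun n hn => by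
      by_contra h; exact hn (dif_neg h))).of_exponent_ge zero_le⟩
    obtain ⟨z, hz, hgz⟩ := hC (show g ∈ ellipsoidIn 𝕂 p q μ from hfmem)
    change edist g z ≤ _ at hgz
    rw [edist_dist] at hgz
    replace hgz : dist g z ≤ ε := (ENNReal.ofReal_le_ofReal_iff hε.le).1 hgz
    refine ⟨res z, Finset.mem_image_of_mem _ (by simpa using hz), ?_⟩
    refine (dist_pi_le_iff hε.le).2 fun n => ?_
    have h1 := (lp.norm_apply_le_norm (zero_lt_one.trans_le hq.out).ne' (g - z) n).trans
      (show ‖g - z‖ ≤ ε by rwa [← dist_eq_norm])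
    rw [lp.coeFn_sub, Pi.sub_apply] at h1
    rw [dist_eq_norm]
    have hgn : (g : ℕ+ → 𝕂) n = x n := by simp [g, f]
    rwa [hgn] at h1
  have h := prod_le_card_of_cover_polydisc (r := fun n : s => μ n / s.card)
    (fun n => by have := hμ n; positivity) hε _ hcov
  rw [hCf.encard_eq_coe_toFinset_card, ENat.toNat_natCast]
  refine (le_of_eq_of_le ?_ h).trans (Nat.cast_le.2 Finset.card_image_le)
  rw [← Finset.prod_coe_sort s]
  simp only [div_div]

theorem isCompact_ellipsoidIn {𝕂 : Type*} [RCLike 𝕂] {p q : ℝ≥0∞}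
    [hp : Fact (1 ≤ p)] [hq : Fact (1 ≤ q)] {μ : ℕ+ → ℝ} (hμ : ∀ n, 0 < μ n) (hs : Summable μ) :
    IsCompact (ellipsoidIn 𝕂 p q μ) := by
  refine isCompact_iff_totallyBounded_isComplete.2 ⟨?_, (isClosed_ellipsoidIn hμ hs).isComplete⟩
  refine Metric.totallyBounded_iff.2 fun ε hε => ?_
  -- Closed balls of radius `ε / 2` fit in open balls of radius `ε`; their net requires a tail of at
  -- most half of `ε / 2`.
  obtain ⟨s, hstail⟩ := summable_iff_vanishing_norm.1 hs (ε / 4) (by positivity)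
  obtain ⟨k, hk, -⟩ := externalCoveringNumber_ellipsoidIn_le (𝕂 := 𝕂) (p := p) (q := q) hμ
    (half_pos hε) (insert 1 s) (Finset.insert_nonempty _ _) (fun t ht => by
      have := hstail t (ht.mono_right (Finset.subset_insert _ _))
      rw [Real.norm_eq_abs] at this
      linarith [le_abs_self (∑ n ∈ t, μ n)])
  have hne := ne_top_of_le_ne_top (ENat.natCast_ne_top k) hk
  simp only [Metric.externalCoveringNumber, ne_eq, iInf_eq_top, Set.encard_eq_top_iff, not_forall,
    Set.not_infinite] at hne
  obtain ⟨C, hC, hCf⟩ := hne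
  refine ⟨C, hCf, fun x hx => ?_⟩
  obtain ⟨y, hy, hxy⟩ := hC hx
  change edist x y ≤ _ at hxy
  rw [edist_dist] at hxy
  have := (ENNReal.ofReal_le_ofReal_iff (half_pos hε).le).1 hxy
  exact Set.mem_biUnion hy (Metric.mem_ball.2 (by linarith))

/-! ### Asymptotics of the exponent sum -/

/-- The increments of `t²/2 log t - t²/4` are controlled by its derivative `t log t`. -/
theorem primitive_mul_log_increment {x y : ℝ} (hx : 1 ≤ x) (hxy : x ≤ y) :
    (y - x) * (x * Real.log x) ≤
        (y ^ 2 / 2 * Real.log y - y ^ 2 / 4) - (x ^ 2 / 2 * Real.log x - x ^ 2 / 4) ∧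
      (y ^ 2 / 2 * Real.log y - y ^ 2 / 4) - (x ^ 2 / 2 * Real.log x - x ^ 2 / 4) ≤
        (y - x) * (y * Real.log y) := by
  rcases hxy.eq_or_lt with rfl | hlt
  · simp
  have hderiv : ∀ t : ℝ, 0 < t →
      HasDerivAt (fun t : ℝ => t ^ 2 / 2 * Real.log t - t ^ 2 / 4) (t * Real.log t) t := by
    intro t ht
    have h1 : HasDerivAt (fun t : ℝ => t ^ 2 / 2) t t := by
      simpa using (hasDerivAt_pow 2 t).div_const 2
    have h2 : HasDerivAt (fun t : ℝ => t ^ 2 / 4) (t / 2) t := by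
      refine ((hasDerivAt_pow 2 t).div_const 4).congr_deriv ?_
      norm_num
      ring
    refine ((h1.mul (Real.hasDerivAt_log ht.ne')).sub h2).congr_deriv ?_
    field_simp
    ring
  obtain ⟨z, hz, hzs⟩ := exists_hasDerivAt_eq_slope
    (fun t : ℝ => t ^ 2 / 2 * Real.log t - t ^ 2 / 4) (fun t => t * Real.log t) hlt
    (fun t ht => (hderiv t (by linarith [ht.1])).continuousAt.continuousWithinAt)
    fun t ht => hderiv t (by linarith [ht.1])
  rw [eq_div_iff (by linarith)] at hzs
  rw [← hzs, mul_comm _ (y - x)]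
  have hz0 : 0 < z := by linarith [hz.1]
  constructor
  · refine mul_le_mul_of_nonneg_left ?_ (by linarith)
    exact mul_le_mul hz.1.le (Real.log_le_log (by linarith) hz.1.le) (Real.log_nonneg hx) hz0.le
  · refine mul_le_mul_of_nonneg_left ?_ (by linarith)
    exact mul_le_mul hz.2.le (Real.log_le_log hz0 hz.2.le) (Real.log_nonneg (by linarith [hz.1]))
      (by linarith)

/-- The increments telescope; the constant `1 / 4` is minus the value of the primitive at `1`. -/
theorem sum_mul_log_bounds (m : ℕ) :
    ((m + 1 : ℝ) ^ 2 / 2 * Real.log (m + 1) - (m + 1 : ℝ) ^ 2 / 4) + 1 / 4 ≤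
        ∑ i ∈ Finset.range (m + 1), ((i : ℝ) + 1) * Real.log (i + 1) ∧
      ∑ i ∈ Finset.range (m + 1), ((i : ℝ) + 1) * Real.log (i + 1) ≤
        ((m + 1 : ℝ) ^ 2 / 2 * Real.log (m + 1) - (m + 1 : ℝ) ^ 2 / 4) + 1 / 4 +
          (m + 1) * Real.log (m + 1) := by
  induction m with
  | zero => norm_num
  | succ m ih =>
    have h := primitive_mul_log_increment (x := (m : ℝ) + 1) (y := (m : ℝ) + 1 + 1)
      (by linarith [(Nat.cast_nonneg m : (0 : ℝ) ≤ m)]) (by linarith)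
    rw [Finset.sum_range_succ]
    push_cast
    constructor <;> linarith [h.1, h.2, ih.1, ih.2]

/-- The exponent `c t (log t - a)` governing the decay of the semi-axes. -/
noncomputable def semiaxisExponent (c a t : ℝ) : ℝ := c * t * (Real.log t - a)

theorem semiaxisExponent_le {c a β t : ℝ} (hc : 0 < c) (hβ : 0 ≤ β) (ht : 0 < t)
    (htN : t ≤ Real.exp (a + β)) : semiaxisExponent c a t ≤ c * Real.exp (a + β) * β := by
  have hlog : Real.log t ≤ a + β := by
    simpa using Real.log_le_log ht htN
  calc c * t * (Real.log t - a) ≤ c * t * β :=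
        mul_le_mul_of_nonneg_left (by linarith) (by positivity)
    _ ≤ _ := by gcongr

theorem le_semiaxisExponent {c a β t : ℝ} (hc : 0 < c)
    (htN : Real.exp (a + β) ≤ t) :
    c * Real.exp (a + β) * β + c * β * (t - Real.exp (a + β)) ≤ semiaxisExponent c a t := by
  have ht : 0 < t := (Real.exp_pos _).trans_le htN
  have hlog : a + β ≤ Real.log t := by
    simpa using Real.log_le_log (Real.exp_pos _) htN
  calc _ = c * t * β := by ring
    _ ≤ c * t * (Real.log t - a) := mul_le_mul_of_nonneg_left (by linarith) (by positivity)

theorem abs_sum_semiaxisExponent_sub_le {c a β : ℝ} (hc : 0 < c) (ha : 0 ≤ a) (hβ : 0 ≤ β) :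
    |∑ i ∈ Finset.range ⌊Real.exp (a + β)⌋₊,
        (c * Real.exp (a + β) * β - semiaxisExponent c a (i + 1)) -
      c * Real.exp (a + β) ^ 2 / 2 * (β + 1 / 2)| ≤
      c * Real.exp (a + β) * (2 * (a + β) + a / 2 + 1 / 4) := by
  set N := Real.exp (a + β) with hN
  have hN1 : 1 ≤ N := Real.one_le_exp (by positivity)
  have hlogN : Real.log N = a + β := Real.log_exp _
  obtain ⟨m, hm⟩ : ∃ m, ⌊N⌋₊ = m + 1 :=
    Nat.exists_eq_succ_of_ne_zero (Nat.floor_pos.2 hN1).ne'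
  have hm1 : (m + 1 : ℝ) ≤ N := by
    have := Nat.floor_le (zero_le_one.trans hN1); rw [hm] at this; exact_mod_cast this
  have hm2 : N < m + 1 + 1 := by
    have := Nat.lt_floor_add_one N; rw [hm] at this; exact_mod_cast this
  have hm0 : (0 : ℝ) ≤ m := Nat.cast_nonneg m
  have hsum : ∑ i ∈ Finset.range (m + 1), (c * N * β - semiaxisExponent c a (i + 1)) =
      (m + 1) * (c * N * β) -
        c * (∑ i ∈ Finset.range (m + 1), ((i : ℝ) + 1) * Real.log (i + 1) -
          a * ((m + 1) * (m + 2) / 2)) := by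
    have hg : ∀ k : ℕ, ∑ i ∈ Finset.range k, ((i : ℝ) + 1) = k * (k + 1) / 2 := by
      intro k
      induction k with
      | zero => simp
      | succ k ih => rw [Finset.sum_range_succ, ih]; push_cast; ring
    have hg' : (m + 1 : ℝ) * (m + 2) / 2 = ∑ i ∈ Finset.range (m + 1), ((i : ℝ) + 1) := by
      rw [hg]; push_cast; ring
    rw [hg', Finset.sum_sub_distrib, Finset.sum_const, Finset.card_range, nsmul_eq_mul,
      Finset.mul_sum (a := a), ← Finset.sum_sub_distrib, Finset.mul_sum]
    push_cast
    congr 1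
    exact Finset.sum_congr rfl fun i _ => by rw [semiaxisExponent]; ring
  obtain ⟨hl, hu⟩ := sum_mul_log_bounds m
  have hinc := primitive_mul_log_increment (x := (m : ℝ) + 1) (y := N) (by linarith) hm1
  have hlogm0 : 0 ≤ Real.log ((m : ℝ) + 1) := Real.log_nonneg (by linarith)
  have hlogm : Real.log ((m : ℝ) + 1) ≤ a + β := by
    rw [← hlogN]; exact Real.log_le_log (by linarith) hm1
  rw [hm, hsum]
  set T := ∑ i ∈ Finset.range (m + 1), ((i : ℝ) + 1) * Real.log (i + 1) with hT
  rw [hlogN] at hinc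
  set G := ((m : ℝ) + 1) ^ 2 / 2 * Real.log (m + 1) - ((m : ℝ) + 1) ^ 2 / 4 with hG
  have hmlog : ((m : ℝ) + 1) * Real.log (m + 1) ≤ N * (a + β) :=
    mul_le_mul hm1 hlogm hlogm0 (by linarith)
  have hNab : 0 ≤ N * (a + β) := by positivity
  have hinc1 : 0 ≤ (N ^ 2 / 2 * (a + β) - N ^ 2 / 4) - G :=
    (mul_nonneg (by linarith) (by positivity)).trans hinc.1
  have hinc2 : (N ^ 2 / 2 * (a + β) - N ^ 2 / 4) - G ≤ N * (a + β) :=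
    hinc.2.trans (mul_le_of_le_one_left hNab (by linarith))
  have hT1 : |T - (N ^ 2 / 2 * (a + β) - N ^ 2 / 4)| ≤ N * (a + β) + 1 / 4 := by
    rw [abs_le]; constructor <;> linarith
  have hQ : |((m : ℝ) + 1) * (m + 2) / 2 - N ^ 2 / 2| ≤ N / 2 := by
    rw [abs_le]; constructor <;> nlinarith
  have hM : |(m + 1 - N)| ≤ 1 := by rw [abs_le]; constructor <;> linarith
  -- Three errors are separated: rounding `N` to `m + 1`, replacing the sum of `n log n` by its
  -- primitive, and replacing the triangular number by `N² / 2`.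
  have hkey : (m + 1) * (c * N * β) - c * (T - a * ((m + 1) * (m + 2) / 2)) -
      c * N ^ 2 / 2 * (β + 1 / 2) =
      c * ((m + 1 - N) * (N * β) - (T - (N ^ 2 / 2 * (a + β) - N ^ 2 / 4)) +
        a * ((m + 1) * (m + 2) / 2 - N ^ 2 / 2)) := by ring
  rw [hkey, abs_mul, abs_of_pos hc, mul_assoc]
  refine mul_le_mul_of_nonneg_left ?_ hc.le
  have e1 : |(m + 1 - N) * (N * β)| ≤ N * β := by
    rw [abs_mul, abs_of_nonneg (show 0 ≤ N * β by positivity)]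
    exact mul_le_of_le_one_left (by positivity) hM
  have e2 : |a * (((m : ℝ) + 1) * (m + 2) / 2 - N ^ 2 / 2)| ≤ a * (N / 2) := by
    rw [abs_mul, abs_of_nonneg ha]
    exact mul_le_mul_of_nonneg_left hQ ha
  have e3 := abs_add_le ((m + 1 - N) * (N * β) - (T - (N ^ 2 / 2 * (a + β) - N ^ 2 / 4)))
    (a * (((m : ℝ) + 1) * (m + 2) / 2 - N ^ 2 / 2))
  have e4 := abs_sub ((m + 1 - N) * (N * β)) (T - (N ^ 2 / 2 * (a + β) - N ^ 2 / 4))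
  have : 0 ≤ N * a := by positivity
  linarith

/-! ### Tail and summability of the semi-axes -/

/-- The first `D` positive integers. -/
def initialPNat (D : ℕ) : Finset ℕ+ :=
  (Finset.range D).map ⟨Nat.succPNat, Nat.succPNat_injective⟩

theorem card_initialPNat (D : ℕ) : (initialPNat D).card = D := by simp [initialPNat]

theorem mem_initialPNat {D : ℕ} {n : ℕ+} : n ∈ initialPNat D ↔ (n : ℕ) ≤ D := by
  simp only [initialPNat, Finset.mem_map, Finset.mem_range, Function.Embedding.coeFn_mk]
  constructor
  · rintro ⟨i, hi, rfl⟩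
    simpa using hi
  · intro h
    exact ⟨n.natPred, by have := n.pos; rw [PNat.natPred]; omega, PNat.succPNat_natPred n⟩

/-- Tail estimate for the semi-axes beyond `exp (a + β)`. -/
theorem sum_tail_semiaxes_le {c a β c₀ : ℝ} (hc : 0 < c) (hβ : 1 ≤ c * β) (hc₀ : 0 < c₀)
    {K : ℕ} (hK : 4 * c₀ * (1 / 2) ^ K ≤ 1) (t : Finset ℕ+)
    (ht : Disjoint t (initialPNat (⌊Real.exp (a + β)⌋₊ + K))) :
    ∑ n ∈ t, c₀ * Real.exp (-semiaxisExponent c a (n : ℕ+)) ≤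
      Real.exp (-(c * Real.exp (a + β) * β)) / 2 := by
  set N := Real.exp (a + β) with hN
  set E := Real.exp (-(c * N * β)) with hE
  have hE0 : 0 < E := Real.exp_pos _
  have hlt : ∀ n ∈ t, ⌊N⌋₊ + K + 1 ≤ (n : ℕ) := fun n hn => by
    have := mt mem_initialPNat.2 (Finset.disjoint_left.1 ht hn)
    omega
  -- Past `N` the exponent grows with slope at least `c β ≥ 1`, so each further index gains a factor
  -- `exp (-1) ≤ 1 / 2`. The `K` skipped indices absorb `4 c₀`.
  have hterm : ∀ n ∈ t, c₀ * Real.exp (-semiaxisExponent c a (n : ℕ+)) ≤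
      E / 4 * (1 / 2) ^ ((n : ℕ) - (⌊N⌋₊ + K + 1)) := by
    intro n hn
    obtain ⟨j, hj⟩ := Nat.exists_eq_add_of_le (hlt n hn)
    have hj' : ((n : ℕ) : ℝ) = ⌊N⌋₊ + K + 1 + j := by rw [hj]; push_cast; ring
    have hfl := Nat.lt_floor_add_one N
    have hnN : ((K + j : ℕ) : ℝ) ≤ n - N := by push_cast; linarith
    have hφ := le_semiaxisExponent (a := a) (β := β) (t := n) hc
      (by have : (0 : ℝ) ≤ (K + j : ℕ) := Nat.cast_nonneg _; linarith)
    have hφ2 : c * N * β + (K + j : ℕ) ≤ semiaxisExponent c a n := by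
      refine le_trans ?_ hφ
      have : (n : ℝ) - N ≤ c * β * (n - N) :=
        le_mul_of_one_le_left ((Nat.cast_nonneg _).trans hnN) hβ
      linarith
    have hexp : Real.exp (-((K + j : ℕ) : ℝ)) ≤ (1 / 2) ^ (K + j) := by
      rw [← mul_one (((K + j : ℕ) : ℝ)), ← mul_neg, Real.exp_nat_mul]
      refine pow_le_pow_left₀ (Real.exp_pos _).le ?_ _
      rw [Real.exp_neg, one_div]
      exact inv_anti₀ two_pos (by linarith [Real.add_one_le_exp 1])
    have hn1 : (n : ℕ) - (⌊N⌋₊ + K + 1) = j := by omega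
    rw [hn1]
    calc c₀ * Real.exp (-semiaxisExponent c a n)
        ≤ c₀ * (E * Real.exp (-((K + j : ℕ) : ℝ))) := by
          rw [hE, ← Real.exp_add]
          exact mul_le_mul_of_nonneg_left (Real.exp_le_exp.2 (by linarith)) hc₀.le
      _ ≤ c₀ * (E * (1 / 2) ^ (K + j)) := by gcongr
      _ = (4 * c₀ * (1 / 2) ^ K) * (E / 4 * (1 / 2) ^ j) := by ring
      _ ≤ 1 * (E / 4 * (1 / 2) ^ j) := by gcongr
      _ = _ := one_mul _
  refine (Finset.sum_le_sum hterm).trans ?_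
  rw [← Finset.mul_sum]
  have hgeom : ∑ n ∈ t, (1 / 2 : ℝ) ^ ((n : ℕ) - (⌊N⌋₊ + K + 1)) ≤ 2 := by
    rw [← Finset.sum_image (s := t) (g := fun n : ℕ+ => (n : ℕ) - (⌊N⌋₊ + K + 1))
      (f := fun k => (1 / 2 : ℝ) ^ k)]
    · exact (summable_geometric_two.sum_le_tsum _ fun _ _ => by positivity).trans_eq
        tsum_geometric_two
    · intro x hx y hy hxy
      have h1 := hlt x hx
      have h2 := hlt y hy
      refine PNat.coe_injective ?_
      simp only at hxy
      omega
  nlinarith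

theorem exists_pow_half_le {c₀ : ℝ} (hc₀ : 0 < c₀) : ∃ K : ℕ, 4 * c₀ * (1 / 2 : ℝ) ^ K ≤ 1 := by
  obtain ⟨K, hK⟩ := exists_pow_lt_of_lt_one (show 0 < 1 / (4 * c₀) by positivity)
    (show (1 / 2 : ℝ) < 1 by norm_num)
  refine ⟨K, ?_⟩
  rw [lt_div_iff₀ (by positivity)] at hK
  linarith

theorem summable_semiaxes {c a c₀ : ℝ} (hc : 0 < c) (hc₀ : 0 < c₀) :
    Summable fun n : ℕ+ => c₀ * Real.exp (-semiaxisExponent c a (n : ℕ+)) := by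
  classical
  obtain ⟨K, hK⟩ := exists_pow_half_le hc₀
  set s := initialPNat (⌊Real.exp (a + c⁻¹)⌋₊ + K) with hs
  have hnn : ∀ n : ℕ+, 0 ≤ c₀ * Real.exp (-semiaxisExponent c a (n : ℕ+)) :=
    fun n => by positivity
  refine summable_of_sum_le (c := ∑ n ∈ s, c₀ * Real.exp (-semiaxisExponent c a (n : ℕ+)) +
    Real.exp (-(c * Real.exp (a + c⁻¹) * c⁻¹)) / 2) hnn fun u => ?_
  rw [← Finset.sum_filter_add_sum_filter_not u (· ∈ s)]
  refine add_le_add (Finset.sum_le_sum_of_subset_of_nonneg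
    (fun n hn => (Finset.mem_filter.1 hn).2) fun n _ _ => hnn n) ?_
  exact sum_tail_semiaxes_le hc (mul_inv_cancel₀ hc.ne').ge hc₀ hK _
    (Finset.disjoint_left.2 fun n hn => (Finset.mem_filter.1 hn).2)

theorem sum_initialPNat (D : ℕ) (f : ℝ → ℝ) :
    ∑ n ∈ initialPNat D, f (n : ℕ+) = ∑ i ∈ Finset.range D, f (i + 1) := by
  simp [initialPNat]

/-! ### Entropy bounds in terms of the cutoff -/

theorem log_externalCoveringNumber_le {𝕂 : Type*} [RCLike 𝕂] {p q : ℝ≥0∞} [Fact (1 ≤ p)]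
    [Fact (1 ≤ q)] {c a c₀ β : ℝ} (hc : 0 < c) (ha : 0 ≤ a) (hc₀ : 0 < c₀) {μ : ℕ+ → ℝ}
    (hμ : ∀ n : ℕ+, μ n = c₀ * Real.exp (-semiaxisExponent c a n)) {K : ℕ}
    (hK : 4 * c₀ * (1 / 2) ^ K ≤ 1) (hβ : 1 ≤ c * β) (hKβ : K ≤ β) {ε : ℝ}
    (hε : ε = Real.exp (-(c * Real.exp (a + β) * β))) :
    Metric.externalCoveringNumber ε.toNNReal (ellipsoidIn 𝕂 p q μ) ≠ ⊤ ∧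
    Real.log (Metric.externalCoveringNumber ε.toNNReal (ellipsoidIn 𝕂 p q μ)).toNat ≤
      Module.finrank ℝ 𝕂 * (∑ i ∈ Finset.range ⌊Real.exp (a + β)⌋₊,
        (c * Real.exp (a + β) * β - semiaxisExponent c a (i + 1)) +
        2 * Real.exp (a + β) * (a + β + Real.log (1 + 8 * c₀))) := by
  set N := Real.exp (a + β) with hN
  have hβ0 : 0 < β := pos_of_mul_pos_right (zero_lt_one.trans_le hβ) hc.le
  have hN1 : 1 ≤ N := Real.one_le_exp (by positivity)
  have hN0 : 0 < N := by linarith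
  have hfl := Nat.floor_le hN0.le
  have hfl2 := Nat.lt_floor_add_one N
  have hm1 : 1 ≤ ⌊N⌋₊ := Nat.floor_pos.2 hN1
  have hμ0 : ∀ n, 0 < μ n := fun n => by rw [hμ]; positivity
  have hε0 : 0 < ε := hε ▸ Real.exp_pos _
  set D := ⌊N⌋₊ + K with hD
  have hD1 : (1 : ℝ) ≤ D := by exact_mod_cast hm1.trans (Nat.le_add_right _ _)
  have hDN : (D : ℝ) ≤ 2 * N := by
    have : β ≤ N := by rw [hN]; linarith [Real.add_one_le_exp (a + β)]
    rw [hD]; push_cast; linarith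
  obtain ⟨k, hk, hkb⟩ := externalCoveringNumber_ellipsoidIn_le (𝕂 := 𝕂) (p := p) (q := q) hμ0 hε0
    (initialPNat D) ⟨1, mem_initialPNat.2 (by exact_mod_cast hD1)⟩ fun t ht => by
      simp only [hμ]
      rw [hε]
      exact sum_tail_semiaxes_le hc hβ hc₀ hK t ht
  refine ⟨ne_top_of_le_ne_top (ENat.natCast_ne_top k) hk, ?_⟩
  rw [card_initialPNat] at hkb
  have hA0 : 0 < 4 * D * c₀ := by positivity
  have hfac : ∀ n : ℕ+, 0 < 1 + 4 * D * μ n / ε := fun n => by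
    have := hμ0 n; positivity
  have hlogk : Real.log (Metric.externalCoveringNumber ε.toNNReal (ellipsoidIn 𝕂 p q μ)).toNat ≤
      Module.finrank ℝ 𝕂 * ∑ n ∈ initialPNat D, Real.log (1 + 4 * D * μ n / ε) := by
    have h1 : ((Metric.externalCoveringNumber ε.toNNReal (ellipsoidIn 𝕂 p q μ)).toNat : ℝ) ≤
        ∏ n ∈ initialPNat D, (1 + 4 * D * μ n / ε) ^ Module.finrank ℝ 𝕂 :=
      (Nat.cast_le.2 (ENat.toNat_le_of_le_natCast hk)).trans hkb
    -- A zero count is not ruled out beforehand; the convention `log 0 = 0` makes that case trivial.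
    rcases Nat.eq_zero_or_pos
      (Metric.externalCoveringNumber ε.toNNReal (ellipsoidIn 𝕂 p q μ)).toNat with h0 | h0
    · rw [h0, Nat.cast_zero, Real.log_zero]
      refine mul_nonneg (Nat.cast_nonneg _) (Finset.sum_nonneg fun n _ => Real.log_nonneg ?_)
      have := hμ0 n
      have : 0 ≤ 4 * D * μ n / ε := by positivity
      linarith
    · refine (Real.log_le_log (by exact_mod_cast h0) h1).trans_eq ?_
      rw [Real.log_prod fun n _ => (pow_pos (hfac n) _).ne', Finset.mul_sum]
      exact Finset.sum_congr rfl fun n _ => Real.log_pow _ _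
  refine hlogk.trans (mul_le_mul_of_nonneg_left ?_ (Nat.cast_nonneg _))
  have hquot : ∀ n : ℕ+, 1 + 4 * D * μ n / ε =
      1 + 4 * D * c₀ * Real.exp (c * N * β - semiaxisExponent c a n) := by
    intro n
    rw [hμ, hε, sub_eq_add_neg, Real.exp_add, Real.exp_neg (c * N * β)]
    field_simp
  simp only [hquot]
  rw [sum_initialPNat D fun t =>
    Real.log (1 + 4 * D * c₀ * Real.exp (c * N * β - semiaxisExponent c a t)), hD,
    Finset.sum_range_add, ← hD]
  -- Up to `⌊N⌋₊` the exponent difference is nonnegative and forms the main term; on the `K` extra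
  -- indices it is nonpositive and only the logarithmic cost remains.
  have hbase : ∀ x : ℝ, 0 ≤ x →
      Real.log (1 + 4 * D * c₀ * Real.exp x) ≤ x + Real.log (1 + 4 * D * c₀) := by
    intro x hx
    rw [← Real.log_exp x, ← Real.log_mul (Real.exp_pos _).ne' (by positivity), Real.log_exp]
    refine Real.log_le_log (by positivity) ?_
    nlinarith [Real.one_le_exp hx]
  have hbase' : ∀ x : ℝ, x ≤ 0 →
      Real.log (1 + 4 * D * c₀ * Real.exp x) ≤ Real.log (1 + 4 * D * c₀) := by
    intro x hx
    refine Real.log_le_log (by positivity) ?_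
    nlinarith [Real.exp_le_one_iff.2 hx]
  have hlogD : Real.log (1 + 4 * D * c₀) ≤ a + β + Real.log (1 + 8 * c₀) := by
    rw [← Real.log_exp (a + β), ← Real.log_mul (Real.exp_pos _).ne' (by positivity), ← hN]
    refine Real.log_le_log (by positivity) ?_
    nlinarith
  have hs1 : ∑ i ∈ Finset.range ⌊N⌋₊,
      Real.log (1 + 4 * D * c₀ * Real.exp (c * N * β - semiaxisExponent c a (i + 1))) ≤
      ∑ i ∈ Finset.range ⌊N⌋₊, (c * N * β - semiaxisExponent c a (i + 1)) +
        ⌊N⌋₊ * Real.log (1 + 4 * D * c₀) := by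
    rw [← nsmul_eq_mul, ← Finset.card_range ⌊N⌋₊, ← Finset.sum_const, Finset.card_range,
      ← Finset.sum_add_distrib]
    refine Finset.sum_le_sum fun i hi => hbase _ (sub_nonneg.2 ?_)
    refine semiaxisExponent_le hc hβ0.le (by positivity) ?_
    have : (i + 1 : ℝ) ≤ ⌊N⌋₊ := by exact_mod_cast Finset.mem_range.1 hi
    linarith
  have hs2 : ∑ x ∈ Finset.range K,
      Real.log (1 + 4 * D * c₀ *
        Real.exp (c * N * β - semiaxisExponent c a (((⌊N⌋₊ + x : ℕ) : ℝ) + 1))) ≤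
      K * Real.log (1 + 4 * D * c₀) := by
    have hcard := Finset.sum_le_card_nsmul (Finset.range K) (fun x : ℕ => Real.log (1 + 4 * D * c₀ *
      Real.exp (c * N * β - semiaxisExponent c a (((⌊N⌋₊ + x : ℕ) : ℝ) + 1))))
      (Real.log (1 + 4 * D * c₀)) ?_
    · rwa [Finset.card_range, nsmul_eq_mul] at hcard
    refine fun i hi => hbase' _ (sub_nonpos.2 ?_)
    have hi0 : (0 : ℝ) ≤ i := Nat.cast_nonneg i
    have hge : N ≤ ((⌊N⌋₊ + i : ℕ) : ℝ) + 1 := by push_cast; linarith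
    refine le_trans ?_ (le_semiaxisExponent (β := β) hc hge)
    have : 0 ≤ c * β * (((⌊N⌋₊ + i : ℕ) : ℝ) + 1 - N) :=
      mul_nonneg (by positivity) (by linarith)
    linarith
  have hlog0 : 0 ≤ Real.log (1 + 4 * D * c₀) := Real.log_nonneg (by linarith)
  have hDlog : (D : ℝ) * Real.log (1 + 4 * D * c₀) ≤
      2 * N * (a + β + Real.log (1 + 8 * c₀)) :=
    mul_le_mul hDN hlogD hlog0 (by positivity)
  have hDeq : (D : ℝ) * Real.log (1 + 4 * D * c₀) =
      ⌊N⌋₊ * Real.log (1 + 4 * D * c₀) + K * Real.log (1 + 4 * D * c₀) := by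
    rw [← add_mul, hD]; push_cast; rfl
  linarith

theorem le_log_externalCoveringNumber {𝕂 : Type*} [RCLike 𝕂] {p q : ℝ≥0∞} [Fact (1 ≤ p)]
    [Fact (1 ≤ q)] {c a c₀ β : ℝ} (ha : 0 ≤ a) (hβ : 0 ≤ β) (hc₀ : 0 < c₀)
    {μ : ℕ+ → ℝ} (hμ : ∀ n : ℕ+, μ n = c₀ * Real.exp (-semiaxisExponent c a n)) {ε : ℝ}
    (hε : ε = Real.exp (-(c * Real.exp (a + β) * β)))
    (hfin : Metric.externalCoveringNumber ε.toNNReal (ellipsoidIn 𝕂 p q μ) ≠ ⊤) :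
    Module.finrank ℝ 𝕂 * (∑ i ∈ Finset.range ⌊Real.exp (a + β)⌋₊,
        (c * Real.exp (a + β) * β - semiaxisExponent c a (i + 1)) -
        Real.exp (a + β) * (a + β + |Real.log c₀|)) ≤
      Real.log (Metric.externalCoveringNumber ε.toNNReal (ellipsoidIn 𝕂 p q μ)).toNat := by
  set N := Real.exp (a + β) with hN
  have hN1 : 1 ≤ N := Real.one_le_exp (by positivity)
  have hN0 : 0 < N := by linarith
  have hfl := Nat.floor_le hN0.le
  have hm1 : (1 : ℝ) ≤ ⌊N⌋₊ := by exact_mod_cast Nat.floor_pos.2 hN1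
  have hμ0 : ∀ n, 0 < μ n := fun n => by rw [hμ]; positivity
  have hε0 : 0 < ε := hε ▸ Real.exp_pos _
  have h := prod_le_externalCoveringNumber_ellipsoidIn (𝕂 := 𝕂) (p := p) (q := q) hμ0 hε0
    (initialPNat ⌊N⌋₊) hfin
  rw [card_initialPNat] at h
  have hfac : ∀ n : ℕ+, 0 < μ n / (⌊N⌋₊ * ε) := fun n => by
    have := hμ0 n; positivity
  refine le_trans ?_ (Real.log_le_log (Finset.prod_pos fun n _ => pow_pos (hfac n) _) h)
  rw [Real.log_prod fun n _ => (pow_pos (hfac n) _).ne']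
  simp only [Real.log_pow]
  rw [← Finset.mul_sum]
  refine mul_le_mul_of_nonneg_left ?_ (Nat.cast_nonneg _)
  have hlog : ∀ n : ℕ+, Real.log (μ n / (⌊N⌋₊ * ε)) =
      (c * N * β - semiaxisExponent c a n) + (Real.log c₀ - Real.log ⌊N⌋₊) := by
    intro n
    rw [Real.log_div (hμ0 n).ne' (by positivity), Real.log_mul (by positivity) hε0.ne', hμ,
      Real.log_mul hc₀.ne' (Real.exp_pos _).ne', hε, Real.log_exp, Real.log_exp]
    ring
  simp only [hlog]
  rw [sum_initialPNat _ fun t =>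
    (c * N * β - semiaxisExponent c a t) + (Real.log c₀ - Real.log ⌊N⌋₊),
    Finset.sum_add_distrib, Finset.sum_const, Finset.card_range, nsmul_eq_mul]
  have hlogm : Real.log ⌊N⌋₊ ≤ a + β := by
    rw [← Real.log_exp (a + β)]; exact Real.log_le_log (by linarith) hfl
  have h1 : (⌊N⌋₊ : ℝ) * (Real.log ⌊N⌋₊ - Real.log c₀) ≤ N * (a + β + |Real.log c₀|) := by
    calc _ ≤ (⌊N⌋₊ : ℝ) * (a + β + |Real.log c₀|) := by
          gcongr
          linarith [neg_abs_le (Real.log c₀)]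
      _ ≤ _ := by gcongr
  linarith

theorem exists_abs_log_externalCoveringNumber_sub_le (𝕂 : Type*) [RCLike 𝕂] (p q : ℝ≥0∞)
    [Fact (1 ≤ p)] [Fact (1 ≤ q)] {c a c₀ : ℝ} (hc : 0 < c) (ha : 0 ≤ a) (hc₀ : 0 < c₀)
    {μ : ℕ+ → ℝ} (hμ : ∀ n : ℕ+, μ n = c₀ * Real.exp (-semiaxisExponent c a n)) :
    ∃ C β₀ : ℝ, 0 ≤ β₀ ∧ ∀ β, β₀ ≤ β → ∀ ε, ε = Real.exp (-(c * Real.exp (a + β) * β)) →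
      |Real.log (Metric.externalCoveringNumber ε.toNNReal (ellipsoidIn 𝕂 p q μ)).toNat -
        Module.finrank ℝ 𝕂 * (c * Real.exp (a + β) ^ 2 / 2 * (β + 1 / 2))| ≤
        C * (Real.exp (a + β) * (β + 1 / 2)) := by
  obtain ⟨K, hK⟩ := exists_pow_half_le hc₀
  set d : ℝ := (Module.finrank ℝ 𝕂 : ℝ)
  have hd : 0 ≤ d := Nat.cast_nonneg _
  set l := Real.log (1 + 8 * c₀) with hl
  have hl0 : 0 ≤ l := Real.log_nonneg (by linarith)
  set C₁ := 2 * c + 2 with hC₁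
  set C₂ := c * (2 * a + a / 2 + 1 / 4) + 2 * a + 2 * l + |Real.log c₀| with hC₂
  have hC₂0 : 0 ≤ C₂ := by positivity
  -- The threshold secures `c β ≥ 1` and `K ≤ β`. The factor `2` on `C₂` lets the `1 / 2` in `β + 1
  -- / 2` absorb the constant term.
  refine ⟨d * (C₁ + 2 * C₂), max c⁻¹ K, (inv_pos.2 hc).le.trans (le_max_left _ _),
    fun β hβ ε hε => ?_⟩
  have hβ1 : 1 ≤ c * β := by
    have := mul_le_mul_of_nonneg_left ((le_max_left _ _).trans hβ) hc.le
    rwa [mul_inv_cancel₀ hc.ne'] at this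
  have hβ0 : 0 < β := pos_of_mul_pos_right (zero_lt_one.trans_le hβ1) hc.le
  obtain ⟨hfin, hup⟩ := log_externalCoveringNumber_le (𝕂 := 𝕂) (p := p) (q := q) hc ha hc₀ hμ hK
    hβ1 ((le_max_right _ _).trans hβ) hε
  have hlo := le_log_externalCoveringNumber (𝕂 := 𝕂) (p := p) (q := q) ha hβ0.le hc₀ hμ hε hfin
  have hS := abs_le.1 (abs_sum_semiaxisExponent_sub_le hc ha hβ0.le)
  set N := Real.exp (a + β)
  have hN0 : 0 < N := Real.exp_pos _
  set S := ∑ i ∈ Finset.range ⌊N⌋₊, (c * N * β - semiaxisExponent c a (i + 1))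
  set P := c * N ^ 2 / 2 * (β + 1 / 2)
  have hbound : N * (C₁ * β + C₂) ≤ (C₁ + 2 * C₂) * (N * (β + 1 / 2)) := by
    have h1 : C₁ * β + C₂ ≤ (C₁ + 2 * C₂) * (β + 1 / 2) := by
      have : 0 ≤ C₁ := by positivity
      nlinarith [mul_nonneg hC₂0 hβ0.le]
    calc _ ≤ N * ((C₁ + 2 * C₂) * (β + 1 / 2)) := mul_le_mul_of_nonneg_left h1 hN0.le
      _ = _ := by ring
  have habs : 0 ≤ N * |Real.log c₀| := by positivity
  have hNl : 0 ≤ N * l := by positivity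
  have hNab : 0 ≤ N * (a + β) := by positivity
  have hexpand : N * (C₁ * β + C₂) = c * N * (2 * (a + β) + a / 2 + 1 / 4) +
      2 * (N * (a + β)) + 2 * (N * l) + N * |Real.log c₀| := by rw [hC₁, hC₂]; ring
  rw [mul_assoc, abs_le, ← mul_neg]
  constructor
  · rw [le_sub_iff_add_le, ← mul_add]
    refine le_trans (mul_le_mul_of_nonneg_left ?_ hd) hlo
    linarith [hS.1]
  · rw [sub_le_iff_le_add, ← mul_add]
    refine hup.trans (mul_le_mul_of_nonneg_left ?_ hd)
    linarith [hS.2]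

/-! ### Passage to the Lambert function and conclusion -/

theorem tendsto_lambertW_atTop : Tendsto lambertW atTop atTop := by
  refine tendsto_atTop.2 fun b => ?_
  -- Truncating `b` at `0` keeps the comparison where `y exp y` is strictly increasing.
  filter_upwards [eventually_ge_atTop 0, eventually_ge_atTop (max b 0 * Real.exp (max b 0))]
    with x hx0 hx
  have hW : lambertW x * Real.exp (lambertW x) = x := (eq_lambertW_iff hx0 _).1 rfl
  have hW0 : 0 ≤ lambertW x := by
    by_contra! h
    nlinarith [mul_neg_of_neg_of_pos h (Real.exp_pos (lambertW x))]
  rw [← hW] at hx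
  exact (le_max_left b 0).trans
    ((mul_exp_strictMonoOn.le_iff_le (le_max_right b 0) hW0).1 hx)

theorem mainTheorem9 {𝕂 : Type*} [RCLike 𝕂] (p q : ℝ≥0∞) [Fact (1 ≤ p)] [Fact (1 ≤ q)]
    (c c' : ℝ) (hc : 0 < c) (hc' : 0 < c') (ψ : ℝ → ℝ)
    (hψ : ∀ t : ℝ, 1 ≤ t → ψ t = c * t * (Real.logb 2 t - c'))
    (μ : ℕ+ → ℝ) (hμ : HasExpDecayingSemiaxes ψ μ)
    (β : ℝ → ℝ) (hβ : ∀ ε : ℝ, β ε = lambertW (Real.log ε⁻¹ / ((2 : ℝ) ^ c' * c))) :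
    (∀ x ∈ ellipsoid 𝕂 p μ, Memℓp x q) ∧
    IsCompact (ellipsoidIn 𝕂 p q μ) ∧
    ∃ r : ℝ → ℝ, r =O[𝓝[>] (0 : ℝ)] (fun ε => Real.exp (-β ε)) ∧
      ∀ᶠ ε in 𝓝[>] (0 : ℝ),
        metricEntropy ε (ellipsoidIn 𝕂 p q μ) =
          realDim 𝕂 * c * (2 : ℝ) ^ (2 * c' - 1) / Real.log 2 *
            Real.exp (2 * β ε) * (β ε + 1 / 2) * (1 + r ε) := by
  have hp : 1 ≤ p := Fact.out
  have hq : 1 ≤ q := Fact.out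
  obtain ⟨c₀, hc₀, hμ⟩ := hμ
  have hlog2 : 0 < Real.log 2 := Real.log_pos one_lt_two
  set a := c' * Real.log 2 with ha
  have ha0 : 0 ≤ a := by positivity
  have h2a : (2 : ℝ) ^ c' = Real.exp a := by rw [Real.rpow_def_of_pos two_pos, ha, mul_comm]
  have hμ' : ∀ n : ℕ+, μ n = c₀ * Real.exp (-semiaxisExponent c a n) := by
    intro n
    rw [hμ, hψ _ (by exact_mod_cast (one_le : 1 ≤ n)), semiaxisExponent, Real.logb, ha]
    congr 3
    field_simp
  have hμ0 : ∀ n, 0 < μ n := fun n => by rw [hμ]; positivity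
  have hsum : Summable μ := by
    rw [show μ = _ from funext hμ']
    exact summable_semiaxes hc hc₀
  refine ⟨fun x hx => memℓp_of_norm_le_summable hq hsum
    (norm_le_of_ellipsoidNorm_le_one hp hμ0 hx.2), isCompact_ellipsoidIn hμ0 hsum, ?_⟩
  obtain ⟨C, β₀, hβ₀, hC⟩ := exists_abs_log_externalCoveringNumber_sub_le 𝕂 p q hc ha0 hc₀ hμ'
  set d : ℝ := (Module.finrank ℝ 𝕂 : ℝ) with hd
  have hd0 : 0 < d := by
    rw [hd]; exact_mod_cast Module.finrank_pos
  have hβlim : Tendsto β (𝓝[>] 0) atTop := by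
    rw [show β = _ from funext hβ]
    refine tendsto_lambertW_atTop.comp (Tendsto.atTop_div_const (by positivity) ?_)
    exact Real.tendsto_log_atTop.comp tendsto_inv_nhdsGT_zero
  have hev : ∀ᶠ ε in 𝓝[>] (0 : ℝ), 0 ≤ β ε ∧
      |metricEntropy ε (ellipsoidIn 𝕂 p q μ) * Real.log 2 -
        d * (c * Real.exp (a + β ε) ^ 2 / 2 * (β ε + 1 / 2))| ≤
        C * (Real.exp (a + β ε) * (β ε + 1 / 2)) := by
    filter_upwards [hβlim.eventually_ge_atTop β₀, Ioo_mem_nhdsGT (zero_lt_one (α := ℝ))]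
      with ε hε1 hε2
    refine ⟨hβ₀.trans hε1, ?_⟩
    have hx0 : 0 ≤ Real.log ε⁻¹ / ((2 : ℝ) ^ c' * c) :=
      div_nonneg (Real.log_nonneg ((one_le_inv₀ hε2.1).2 hε2.2.le)) (by positivity)
    -- The Lambert equation, cleared of denominators, is `ε = exp (-(c N β))` with `N = exp (a +
    -- β)`.
    have hW := (eq_lambertW_iff hx0 _).1 (hβ ε)
    rw [h2a, eq_div_iff (by positivity)] at hW
    have hεeq : ε = Real.exp (-(c * Real.exp (a + β ε) * β ε)) := by
      rw [Real.exp_add a, show c * (Real.exp a * Real.exp (β ε)) * β ε =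
        β ε * Real.exp (β ε) * (Real.exp a * c) by ring, hW, Real.log_inv, neg_neg,
        Real.exp_log hε2.1]
    have h := hC (β ε) hε1 ε hεeq
    rwa [metricEntropy, Real.logb, div_mul_cancel₀ _ hlog2.ne']
  set main : ℝ → ℝ := fun ε => realDim 𝕂 * c * (2 : ℝ) ^ (2 * c' - 1) / Real.log 2 *
            Real.exp (2 * β ε) * (β ε + 1 / 2) with hmain
  have hmaineq : ∀ ε, main ε * Real.log 2 =
      d * (c * Real.exp (a + β ε) ^ 2 / 2 * (β ε + 1 / 2)) := by
    intro ε
    have h1 : (2 : ℝ) ^ (2 * c' - 1) = Real.exp a ^ 2 / 2 := by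
      rw [Real.rpow_sub two_pos, Real.rpow_one, mul_comm, Real.rpow_mul two_pos.le, h2a]
      norm_num
    have h2 : Real.exp (2 * β ε) = Real.exp (β ε) ^ 2 := by
      rw [← Real.exp_nat_mul]; norm_num
    simp only [hmain]
    rw [h1, h2, Real.exp_add, realDim, ← hd]
    field_simp
  have hmainpos : ∀ ε, 0 ≤ β ε → 0 < main ε := by
    intro ε h
    have := hmaineq ε
    have h2 : 0 < d * (c * Real.exp (a + β ε) ^ 2 / 2 * (β ε + 1 / 2)) := by positivity
    rw [← this] at h2
    exact pos_of_mul_pos_left h2 hlog2.le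
  -- With `r` defined as the quotient minus one, the asymptotic identity is exact wherever the main
  -- term is nonzero.
  refine ⟨fun ε => metricEntropy ε (ellipsoidIn 𝕂 p q μ) / main ε - 1, ?_, ?_⟩
  -- The constant is the quotient of `C N (β + 1/2)` by `d c N² / 2 · (β + 1/2)`, with the factor
  -- `exp (-β)` of `1 / N` removed.
  · refine IsBigO.of_bound (2 * C / (d * c * Real.exp a)) ?_
    filter_upwards [hev] with ε ⟨hε0, hε⟩
    have hm := hmainpos ε hε0
    rw [← hmaineq ε, ← sub_mul, abs_mul, abs_of_pos hlog2] at hε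
    rw [Real.norm_eq_abs, Real.norm_eq_abs, abs_of_pos (Real.exp_pos _), div_sub_one hm.ne',
      abs_div, abs_of_pos hm, div_le_iff₀ hm]
    refine le_of_mul_le_mul_right (hε.trans_eq ?_) hlog2
    rw [mul_assoc _ (main ε), hmaineq, Real.exp_add, Real.exp_neg]
    field_simp
  · filter_upwards [hev] with ε ⟨hε0, _⟩
    have hm := hmainpos ε hε0
    change _ = main ε * (1 + (_ - 1))
    rw [add_sub_cancel, mul_div_cancel₀ _ hm.ne']
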